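/- Let $n\ge p\ge 2$ be integers, let $\tau>0$, let $0<\varepsilon<(5-\sqrt5)/10$, let $\mu^*\in\mathbb R^p$, and let $\Sigma$ be a (possibly unknown and arbitrary) positive semidefinite real $p\times p$ matrix. *Model.* A random vector $\xi$ in $\mathbb R^p$ is called sub-Gaussian with variance proxy $\tau$ if $\mathbf E[\xi]=0$ and $\mathbf E[e^{v^\top\xi}]\le e^{\tau\|v\|_2^2/2}$ for all $v\in\mathbb R^p$. The random vectors $X_1,\dots,X_n$ in $\mathbb R^p$ are said to follow the sub-Gaussian model with adversarial contamination $\mathrm{SGAC}(\mu^*,\Sigma,\varepsilon)$ if there are independent random vectors $\xi_1,\dots,\xi_n$, each sub-Gaussian with variance proxy $\tau$, such that, almost surely, $|\{i: X_i\ne\mu^*+\Sigma^{1/2}\xi_i\}|\le\varepsilon n$. (The contaminated indices and the values taken there may depend arbitrarily on $\xi_1,\dots,\xi_n$.) *Estimator.* Set $$K=\max\Big(0,\Big\lceil\frac{\log(4p)-2\log(\varepsilon(1-2\varepsilon))}{2\log(1-2\varepsilon)-\log\varepsilon-\log(1-\varepsilon)}\Big\rceil\Big).$$ Let $\widehat\mu^0$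 be a minimizer of $\mu\mapsto\sum_{i=1}^n\|X_i-\mu\|_2$ over $\mathbb R^p$. For $k=1,\dots,K$, let $\widehat w^k$ be a minimizer of $$w\mapsto\lambda_{\max}\Big(\sum_{i=1}^n w_i\,(X_i-\widehat\mu^{k-1})(X_i-\widehat\mu^{k-1})^\top\Big)$$ over all $w\in[0,1]^n$ with $\sum_i w_i=1$ and $(n-n\varepsilon)\max_i w_i\le1$, and put $\widehat\mu^k=\sum_{i=1}^n\widehat w^k_iX_i$. The iteratively reweighted mean is $\widehat\mu_n^{\mathrm{IR}}=\widehat\mu^K$. The computation uses $\varepsilon$ but not $\Sigma$. *Claim.* There is a constant $A_5>0$ depending only on $\tau$ such that for all $n,p,\varepsilon,\Sigma,\mu^*$ as above, every $\delta\in(4e^{-n},1)$, and all $X_1,\dots,X_n$ following $\mathrm{SGAC}(\mu^*,\Sigma,\varepsilon)$, there is an event of probability at least $1-4\delta$ on which $\widehat\mu_n^{\mathrm{IR}}$ exists and, whichever minimizers are chosen in its computation, $$\|\widehat\mu_n^{\mathrm{IR}}-\mu^*\|_2\le\frac{A_5\,\|\Sigma\|_{\mathrm{op}}^{1/2}}{1-2\varepsilon-\sqrt{\varepsilon(1-\varepsilon)}}\bigg(\sqrt{\frac{p+\log(4/\delta)}{n}}+3\sqrt{\varepsilon}\bigg).$$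 -/

import Mathlib

open MeasureTheory ProbabilityTheory
open scoped MatrixOrder

noncomputable section

/-- The largest eigenvalue of a real symmetric matrix (of positive size). -/
def lambdaMax {p : ℕ} (M : Matrix (Fin p) (Fin p) ℝ) : ℝ :=
  sSup (spectrum ℝ M)

/-- The operator norm of a matrix with respect to Euclidean norms. -/
def opNorm {p : ℕ} (M : Matrix (Fin p) (Fin p) ℝ) : ℝ :=
  ‖Matrix.toEuclideanCLM (n := Fin p) (𝕜 := ℝ) M‖

/-- `v ⊗ v = v vᵀ`. -/
def tensorSq {p : ℕ} (v : EuclideanSpace ℝ (Fin p)) : Matrix (Fin p) (Fin p) ℝ :=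
  Matrix.vecMulVec v.ofLp v.ofLp

/-- `M^{1/2} v`, where `M^{1/2}` is the positive semidefinite square root of the positive
semidefinite matrix `M`. -/
def sqrtApply {p : ℕ} (M : Matrix (Fin p) (Fin p) ℝ) (v : EuclideanSpace ℝ (Fin p)) :
    EuclideanSpace ℝ (Fin p) :=
  Matrix.toEuclideanCLM (n := Fin p) (𝕜 := ℝ) (CFC.sqrt M) v

/-- A random vector is centred and sub-Gaussian with variance proxy `τ`:
`E exp (vᵀ ξ) ≤ exp (τ ‖v‖² / 2)` for every vector `v`. -/
structure IsSubGaussianVector {Ω : Type*} [MeasurableSpace Ω] (P : Measure Ω) {p : ℕ}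
    (τ : ℝ) (ξ : Ω → EuclideanSpace ℝ (Fin p)) : Prop where
  measurable : Measurable ξ
  integrable : Integrable ξ P
  mean_zero : ∫ ω, ξ ω ∂P = 0
  integrable_exp : ∀ v : EuclideanSpace ℝ (Fin p),
    Integrable (fun ω => Real.exp (inner ℝ v (ξ ω))) P
  exp_moment_le : ∀ v : EuclideanSpace ℝ (Fin p),
    ∫ ω, Real.exp (inner ℝ v (ξ ω)) ∂P ≤ Real.exp (τ / 2 * ‖v‖ ^ 2)

/-- The random vectors `X₁, …, Xₙ` follow the sub-Gaussian model with adversarial contamination: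
they coincide with `μ + S^{1/2} ξᵢ`, for independent sub-Gaussian vectors `ξᵢ` with variance
proxy `τ`, except for at most `ε n` indices. Both the set of the exceptional indices and the
values taken there may depend on `ω` and on the `ξᵢ` in an arbitrary way. -/
structure IsSGAC {Ω : Type*} [MeasurableSpace Ω] (P : Measure Ω) {n p : ℕ} (τ : ℝ)
    (μ : EuclideanSpace ℝ (Fin p)) (S : Matrix (Fin p) (Fin p) ℝ) (ε : ℝ)
    (X : Fin n → Ω → EuclideanSpace ℝ (Fin p)) : Prop where
  measurable : ∀ i, Measurable (X i)
  contaminated : ∃ ξ : Fin n → Ω → EuclideanSpace ℝ (Fin p),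
    (∀ i, IsSubGaussianVector P τ (ξ i)) ∧ iIndepFun ξ P ∧
    ∀ᵐ ω ∂P, (({i : Fin n | X i ω ≠ μ + sqrtApply S (ξ i ω)}.ncard : ℕ) : ℝ) ≤ ε * n

/-- The feasible weights: `w` in the probability simplex with `(n - n ε) ‖w‖_∞ ≤ 1`
(the norm on `Fin n → ℝ` is the sup norm). -/
def feasibleWeights (n : ℕ) (ε : ℝ) : Set (Fin n → ℝ) :=
  {w | w ∈ stdSimplex ℝ (Fin n) ∧ ((n : ℝ) - n * ε) * ‖w‖ ≤ 1}

/-- The largest eigenvalue of the weighted second-moment matrix `∑ wᵢ (xᵢ - m)(xᵢ - m)ᵀ`. -/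
def weightCost {n p : ℕ} (x : Fin n → EuclideanSpace ℝ (Fin p)) (m : EuclideanSpace ℝ (Fin p))
    (w : Fin n → ℝ) : ℝ :=
  lambdaMax (∑ i, w i • tensorSq (x i - m))

/-- `m` is a geometric median of the data `x`. -/
def IsGeometricMedian {n p : ℕ} (x : Fin n → EuclideanSpace ℝ (Fin p))
    (m : EuclideanSpace ℝ (Fin p)) : Prop :=
  ∀ m' : EuclideanSpace ℝ (Fin p), ∑ i, ‖x i - m‖ ≤ ∑ i, ‖x i - m'‖

/-- `m'` is obtained from the current estimate `m` by one reweighting step: it is the weighted mean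
for some minimizer of `weightCost x m` over the feasible weights. -/
def IsReweightingStep {n p : ℕ} (ε : ℝ) (x : Fin n → EuclideanSpace ℝ (Fin p))
    (m m' : EuclideanSpace ℝ (Fin p)) : Prop :=
  ∃ w ∈ feasibleWeights n ε, IsMinOn (weightCost x m) (feasibleWeights n ε) w ∧
    m' = ∑ i, w i • x i

/-- The number of iterations (`Nat.ceil` is the ceiling, replaced by `0` when it is negative). -/
def numIterations (p : ℕ) (ε : ℝ) : ℕ :=
  ⌈(Real.log (4 * p) - 2 * Real.log (ε * (1 - 2 * ε))) /
    (2 * Real.log (1 - 2 * ε) - Real.log ε - Real.log (1 - ε))⌉₊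

/-- `m` is an output, for some choice of the minimizers, of the iteratively reweighted mean
algorithm with known contamination rate `ε` and unknown covariance, run on the data `x`. -/
def IsIterativelyReweightedMean {n p : ℕ} (ε : ℝ) (x : Fin n → EuclideanSpace ℝ (Fin p))
    (m : EuclideanSpace ℝ (Fin p)) : Prop :=
  ∃ est : ℕ → EuclideanSpace ℝ (Fin p),
    IsGeometricMedian x (est 0) ∧
    (∀ k < numIterations p ε, IsReweightingStep ε x (est k) (est (k + 1))) ∧
    m = est (numIterations p ε)

end

/-!
The argument separates a deterministic error bound from two concentration inequalities.

*Deterministic part.* Let `ζᵢ = S^{1/2} ξᵢ` be the uncontaminated noise, and suppose that its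
empirical second moment in every unit direction is at most `B²` and that its empirical mean has norm
at most `R`. For feasible weights the outliers carry mass at most `ε / (1 - ε)`. In a
reweighting step from `m` to `m'`, Cauchy–Schwarz over the outliers and the comparison of the
minimal cost with the cost `(B / √(1 - ε) + ‖m - μ‖)²` of the uniform weights on the inliers give
`‖m' - μ‖ ≤ α ‖m - μ‖ + R + 3 √ε B / (1 - 2ε)` with `α = √(ε(1 - ε)) / (1 - 2ε) < 1`
(`IsReweightingStep.norm_sub_le`). The noise of the reweighted inliers enters only through `R` and
`B`, because feasible weights are within `O(ε)` of uniform ones in `ℓ¹`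
(`abs_sum_mul_le_of_mem_feasibleWeights`); no union bound over sets of inliers is needed. The
geometric median has an error of order `B √p` (`IsGeometricMedian.norm_sub_le`), and the number of
iterations makes `α ^ K √p` at most of order `ε` (`pow_numIterations_le`). Summing the geometric
series gives `IsIterativelyReweightedMean.norm_sub_le`.

*Probabilistic part.* Both `B` and `R` are norms of sub-Gaussian objects. Instead of a net, the
exponential moment of a midpoint-convex random function is averaged over the unit ball, which
dominates its value at every `v / 2` up to the volume factor `2 ^ d`
(`exists_lintegral_le_and_exp_half_le`). Once in `ℝᵖ` this gives
`‖∑ ξᵢ‖ ≲ √(n (p + log (4 / δ)))` (`measure_norm_sum_gt_le`), and applied in `ℝⁿ` and then in `ℝᵖ`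
it gives `∑ ⟨v, ξᵢ⟩² ≲ n ‖v‖²` (`measure_sum_inner_sq_gt_le`), where `p ≤ n` and
`log (4 / δ) ≤ n` keep the constant absolute.
-/

/-! ### Averaging exponential moments over a ball -/

lemma two_mul_exp_le_exp_add_exp {a b c : ℝ} (h : 2 * a ≤ b + c) :
    2 * Real.exp a ≤ Real.exp b + Real.exp c := by
  have h1 : Real.exp a ≤ Real.exp (b / 2) * Real.exp (c / 2) := by
    rw [← Real.exp_add]; exact Real.exp_le_exp.2 (by linarith)
  have h2 : Real.exp b = Real.exp (b / 2) ^ 2 := by rw [← Real.exp_nat_mul]; congr 1; push_cast; ring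
  have h3 : Real.exp c = Real.exp (c / 2) ^ 2 := by rw [← Real.exp_nat_mul]; congr 1; push_cast; ring
  nlinarith [sq_nonneg (Real.exp (b / 2) - Real.exp (c / 2))]

section Averaging

variable {E : Type*} [NormedAddCommGroup E] [NormedSpace ℝ E] [FiniteDimensional ℝ E]
  [MeasurableSpace E] [BorelSpace E]

/-- The value of a midpoint-convex function at the centre of a ball is at most its average. -/
lemma mul_measure_closedBall_le_setLIntegral (ν : Measure E) [ν.IsAddHaarMeasure]
    {f : E → ENNReal} (hf : Measurable f) (c : E) (r : ℝ)
    (hmid : ∀ h, 2 * f c ≤ f (c + h) + f (c - h)) :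
    f c * ν (Metric.closedBall 0 r) ≤ ∫⁻ u in Metric.closedBall c r, f u ∂ν := by
  have h1 : ∫⁻ h in Metric.closedBall 0 r, f (c + h) ∂ν = ∫⁻ u in Metric.closedBall c r, f u ∂ν := by
    rw [← (measurePreserving_add_left ν c).setLIntegral_comp_preimage
      Metric.isClosed_closedBall.measurableSet hf]
    congr 2
    ext h; simp
  have h2 : ∫⁻ h in Metric.closedBall 0 r, f (c - h) ∂ν = ∫⁻ u in Metric.closedBall c r, f u ∂ν := by
    rw [← (Measure.measurePreserving_sub_left ν c).setLIntegral_comp_preimage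
      Metric.isClosed_closedBall.measurableSet hf]
    congr 2
    ext h; simp
  have h3 : 2 * (f c * ν (Metric.closedBall 0 r)) ≤
      2 * ∫⁻ u in Metric.closedBall c r, f u ∂ν := by
    calc 2 * (f c * ν (Metric.closedBall 0 r))
        = ∫⁻ _ in Metric.closedBall 0 r, 2 * f c ∂ν := by
          rw [setLIntegral_const, mul_assoc]
      _ ≤ ∫⁻ h in Metric.closedBall 0 r, (f (c + h) + f (c - h)) ∂ν :=
          lintegral_mono fun h => hmid h
      _ = 2 * ∫⁻ u in Metric.closedBall c r, f u ∂ν := by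
          rw [lintegral_add_left (by fun_prop), h1, h2, two_mul]
  exact (ENNReal.mul_le_mul_iff_right (by norm_num) (by norm_num)).1 h3

/-- A pointwise bound on the exponential moments of a random midpoint-convex function gives a
uniform one, at the price of halving the argument and of a factor `2 ^ d`. The majorant `Φ` is the
average over the unit ball: it dominates the value at `v / 2` because the ball of centre `v / 2` and
radius `1 / 2` lies in the unit ball and has `2 ^ (-d)` of its volume. -/
lemma exists_lintegral_le_and_exp_half_le {Ω : Type*} [MeasurableSpace Ω] (P : Measure Ω)
    [SFinite P] {F : Ω → E → ℝ} (hF : Measurable (Function.uncurry F))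
    (hmid : ∀ ω c h, 2 * F ω c ≤ F ω (c + h) + F ω (c - h)) {M : ENNReal}
    (hM : ∀ u, ‖u‖ ≤ 1 → ∫⁻ ω, ENNReal.ofReal (Real.exp (F ω u)) ∂P ≤ M) :
    ∃ Φ : Ω → ENNReal, Measurable Φ ∧ ∫⁻ ω, Φ ω ∂P ≤ 2 ^ Module.finrank ℝ E * M ∧
      ∀ ω v, ‖v‖ ≤ 1 → ENNReal.ofReal (Real.exp (F ω ((1 / 2 : ℝ) • v))) ≤ Φ ω := by
  obtain ⟨ν, hν⟩ : ∃ ν : Measure E, ν.IsAddHaarMeasure := ⟨Measure.addHaar, inferInstance⟩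
  set B := ν (Metric.closedBall (0 : E) 1) with hB
  have hB0 : B ≠ 0 := (Metric.measure_closedBall_pos ν 0 one_pos).ne'
  have hBt : B ≠ ⊤ := measure_closedBall_lt_top.ne
  set D : ENNReal := 2 ^ Module.finrank ℝ E with hD
  have hD0 : D ≠ 0 := by simp [hD]
  have hDt : D ≠ ⊤ := by simp [hD]
  have hexp : Measurable (Function.uncurry fun ω u => ENNReal.ofReal (Real.exp (F ω u))) :=
    ENNReal.measurable_ofReal.comp (Real.measurable_exp.comp hF)
  have hexp' : ∀ ω, Measurable fun u => ENNReal.ofReal (Real.exp (F ω u)) :=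
    fun ω => hexp.comp measurable_prodMk_left
  refine ⟨fun ω => D * B⁻¹ * ∫⁻ u in Metric.closedBall 0 1, ENNReal.ofReal (Real.exp (F ω u)) ∂ν,
    (hexp.lintegral_prod_right').const_mul _, ?_, fun ω v hv => ?_⟩
  · have hswap : ∫⁻ ω, ∫⁻ u in Metric.closedBall 0 1, ENNReal.ofReal (Real.exp (F ω u)) ∂ν ∂P =
        ∫⁻ u in Metric.closedBall 0 1, ∫⁻ ω, ENNReal.ofReal (Real.exp (F ω u)) ∂P ∂ν :=
      lintegral_lintegral_swap hexp.aemeasurable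
    have hmul : ∫⁻ ω, D * B⁻¹ * (∫⁻ u in Metric.closedBall 0 1,
          ENNReal.ofReal (Real.exp (F ω u)) ∂ν) ∂P =
        D * B⁻¹ * ∫⁻ ω, ∫⁻ u in Metric.closedBall 0 1, ENNReal.ofReal (Real.exp (F ω u)) ∂ν ∂P :=
      lintegral_const_mul _ hexp.lintegral_prod_right'
    rw [hmul, hswap]
    calc D * B⁻¹ * ∫⁻ u in Metric.closedBall 0 1, ∫⁻ ω, ENNReal.ofReal (Real.exp (F ω u)) ∂P ∂ν
        ≤ D * B⁻¹ * ∫⁻ u in Metric.closedBall (0 : E) 1, M ∂ν := by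
          refine mul_le_mul_right ?_ _
          exact setLIntegral_mono measurable_const fun u hu => hM u (mem_closedBall_zero_iff.1 hu)
      _ = D * M := by
          rw [setLIntegral_const, ← hB, mul_comm M, ← mul_assoc, mul_assoc D,
            ENNReal.inv_mul_cancel hB0 hBt, mul_one]
  · have h1 := mul_measure_closedBall_le_setLIntegral ν (hexp' ω) ((1 / 2 : ℝ) • v) (1 / 2)
      (fun h => by
        rw [← ENNReal.ofReal_add (Real.exp_nonneg _) (Real.exp_nonneg _),
          show (2 : ENNReal) = ENNReal.ofReal 2 by simp, ← ENNReal.ofReal_mul (by norm_num)]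
        exact ENNReal.ofReal_le_ofReal (two_mul_exp_le_exp_add_exp (hmid ω _ h)))
    have h2 : Metric.closedBall ((1 / 2 : ℝ) • v) (1 / 2) ⊆ Metric.closedBall 0 1 := by
      apply Metric.closedBall_subset_closedBall'
      rw [dist_zero_right, norm_smul]
      norm_num
      linarith
    have h3 := h1.trans (lintegral_mono_set h2)
    rw [Measure.addHaar_closedBall' ν _ (by norm_num), ← hB] at h3
    have h4 : ENNReal.ofReal ((1 / 2) ^ Module.finrank ℝ E) = D⁻¹ := by
      rw [ENNReal.ofReal_pow (by norm_num), hD, ENNReal.inv_pow, one_div,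
        ENNReal.ofReal_inv_of_pos (by norm_num)]
      simp
    rw [h4] at h3
    calc ENNReal.ofReal (Real.exp (F ω ((1 / 2 : ℝ) • v)))
        = D * B⁻¹ * (ENNReal.ofReal (Real.exp (F ω ((1 / 2 : ℝ) • v))) * (D⁻¹ * B)) := by
          rw [show ∀ x : ENNReal, D * B⁻¹ * (x * (D⁻¹ * B)) = x * (D * D⁻¹) * (B⁻¹ * B) by
            intro x; ring, ENNReal.mul_inv_cancel hD0 hDt, ENNReal.inv_mul_cancel hB0 hBt]
          simp
      _ ≤ _ := mul_le_mul_right h3 _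

end Averaging

/-! ### Concentration of sums of independent sub-Gaussian vectors -/

section Concentration

variable {Ω : Type*} [MeasurableSpace Ω] {P : Measure Ω}

lemma measure_gt_le_of_lintegral_le {Φ : Ω → ENNReal} (hΦ : Measurable Φ) {C δ : ℝ} (hδ : 0 < δ)
    (h : ∫⁻ ω, Φ ω ∂P ≤ ENNReal.ofReal (Real.exp C)) :
    P {ω | ¬ Φ ω ≤ ENNReal.ofReal (Real.exp (C + Real.log (1 / δ)))} ≤ ENNReal.ofReal δ := by
  set t := ENNReal.ofReal (Real.exp (C + Real.log (1 / δ))) with ht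
  have ht0 : t ≠ 0 := by simp [ht, Real.exp_pos]
  have htt : t ≠ ⊤ := ENNReal.ofReal_ne_top
  calc P {ω | ¬ Φ ω ≤ t} ≤ P {ω | t ≤ Φ ω} :=
        measure_mono fun ω hω => (not_le.1 hω).le
    _ ≤ (∫⁻ ω, Φ ω ∂P) / t := meas_ge_le_lintegral_div hΦ.aemeasurable ht0 htt
    _ ≤ ENNReal.ofReal (Real.exp C) / t := by gcongr
    _ = ENNReal.ofReal δ := by
        rw [ht, ← ENNReal.ofReal_div_of_pos (Real.exp_pos _), ← Real.exp_sub]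
        congr 1
        rw [show C - (C + Real.log (1 / δ)) = Real.log δ by
          rw [one_div, Real.log_inv]; ring, Real.exp_log hδ]

lemma two_pow_mul_ofReal_exp (d : ℕ) (C : ℝ) :
    (2 : ENNReal) ^ d * ENNReal.ofReal (Real.exp C) =
      ENNReal.ofReal (Real.exp (d * Real.log 2 + C)) := by
  rw [Real.exp_add, mul_comm (d : ℝ), Real.exp_mul, Real.exp_log (by norm_num),
    Real.rpow_natCast, ENNReal.ofReal_mul (by positivity), ENNReal.ofReal_pow (by norm_num)]
  simp

variable {n p : ℕ} {τ : ℝ} {ξ : Fin n → Ω → EuclideanSpace ℝ (Fin p)}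

/-- By independence, the family `(ξᵢ)` is jointly sub-Gaussian. -/
lemma lintegral_exp_sum_inner_le (hξ : ∀ i, IsSubGaussianVector P τ (ξ i)) (hind : iIndepFun ξ P)
    (c : Fin n → EuclideanSpace ℝ (Fin p)) :
    ∫⁻ ω, ENNReal.ofReal (Real.exp (∑ i, inner ℝ (c i) (ξ i ω))) ∂P ≤
      ENNReal.ofReal (Real.exp (τ / 2 * ∑ i, ‖c i‖ ^ 2)) := by
  have hm : ∀ i, Measurable fun x : EuclideanSpace ℝ (Fin p) =>
      ENNReal.ofReal (Real.exp (inner ℝ (c i) x)) := fun i => by fun_prop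
  calc ∫⁻ ω, ENNReal.ofReal (Real.exp (∑ i, inner ℝ (c i) (ξ i ω))) ∂P
      = ∫⁻ ω, ∏ i, ENNReal.ofReal (Real.exp (inner ℝ (c i) (ξ i ω))) ∂P := by
        simp_rw [Real.exp_sum, ENNReal.ofReal_prod_of_nonneg fun i _ => Real.exp_nonneg _]
    _ = ∏ i, ∫⁻ ω, ENNReal.ofReal (Real.exp (inner ℝ (c i) (ξ i ω))) ∂P := by
        have := lintegral_prod_eq_prod_lintegral_of_indepFun Finset.univ _ (hind.comp _ hm)
          (fun i => (hm i).comp (hξ i).measurable)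
        simpa [Finset.prod_apply] using this
    _ ≤ ∏ i, ENNReal.ofReal (Real.exp (τ / 2 * ‖c i‖ ^ 2)) := by
        refine Finset.prod_le_prod' fun i _ => ?_
        rw [← ofReal_integral_eq_lintegral_ofReal ((hξ i).integrable_exp _)
          (ae_of_all _ fun _ => Real.exp_nonneg _)]
        exact ENNReal.ofReal_le_ofReal ((hξ i).exp_moment_le _)
    _ = _ := by
        rw [← ENNReal.ofReal_prod_of_nonneg fun i _ => Real.exp_nonneg _, ← Real.exp_sum,
          Finset.mul_sum]

/-- Concentration of the sum in norm, from the average of `exp (λ ⟨u, ∑ ξᵢ⟩)` over the unit ball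
of `ℝᵖ`. -/
lemma measure_norm_sum_gt_le [SFinite P] (hτ : 0 < τ) (hn : 0 < n)
    (hξ : ∀ i, IsSubGaussianVector P τ (ξ i)) (hind : iIndepFun ξ P)
    {δ q : ℝ} (hδ : 0 < δ) (hq : 0 < q) (hq' : p + Real.log (1 / δ) ≤ q) :
    P {ω | ¬ ‖∑ i, ξ i ω‖ ≤ 3 * Real.sqrt (q * τ * n)} ≤ ENNReal.ofReal δ := by
  have hn' : (0 : ℝ) < n := by exact_mod_cast hn
  -- this value of the exponent balances `τ l² n / 2` against `q`
  set l := Real.sqrt (q / (τ * n)) with hl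
  have hl0 : 0 < l := Real.sqrt_pos.2 (by positivity)
  have hl2 : l ^ 2 * (τ * n) = q := by
    rw [hl, Real.sq_sqrt (by positivity)]; field_simp
  have hξm := fun i => (hξ i).measurable
  obtain ⟨Φ, hΦ, hΦi, hΦl⟩ := exists_lintegral_le_and_exp_half_le P
    (F := fun ω u => l * inner ℝ u (∑ i, ξ i ω)) (M := ENNReal.ofReal (Real.exp (q / 2)))
    (by unfold Function.uncurry; fun_prop)
    (fun ω c h => by rw [inner_add_left, inner_sub_left]; linarith)
    (fun u hu => by
      have h1 := lintegral_exp_sum_inner_le hξ hind fun _ => l • u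
      simp_rw [← inner_sum, inner_smul_left] at h1
      refine h1.trans (ENNReal.ofReal_le_ofReal (Real.exp_le_exp.2 ?_))
      rw [Finset.sum_const, norm_smul, mul_pow, Real.norm_eq_abs, sq_abs]
      simp only [Finset.card_univ, Fintype.card_fin, nsmul_eq_mul]
      have : ‖u‖ ^ 2 ≤ 1 := by nlinarith [norm_nonneg u]
      calc τ / 2 * (n * (l ^ 2 * ‖u‖ ^ 2)) = (l ^ 2 * (τ * n)) * ‖u‖ ^ 2 / 2 := by ring
        _ = q * ‖u‖ ^ 2 / 2 := by rw [hl2]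
        _ ≤ q / 2 := by nlinarith)
  rw [two_pow_mul_ofReal_exp, finrank_euclideanSpace_fin] at hΦi
  refine (measure_mono fun ω hω => ?_).trans (measure_gt_le_of_lintegral_le hΦ hδ hΦi)
  refine fun hle => hω ?_
  set s := ∑ i, ξ i ω with hs
  by_cases hs0 : s = 0
  · rw [hs0, norm_zero]; positivity
  have hspos : 0 < ‖s‖ := norm_pos_iff.2 hs0
  have h1 := (hΦl ω (‖s‖⁻¹ • s) (by
    rw [norm_smul, norm_inv, norm_norm, inv_mul_cancel₀ hspos.ne'])).trans hle
  rw [ENNReal.ofReal_le_ofReal_iff (Real.exp_nonneg _), Real.exp_le_exp] at h1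
  simp only [inner_smul_left, real_inner_self_eq_norm_sq, ← hs] at h1
  have h2 : l * ((1 / 2) * (‖s‖⁻¹ * ‖s‖ ^ 2)) = l * ‖s‖ / 2 := by field_simp
  have h3 : l * ‖s‖ / 2 ≤ p * Real.log 2 + q / 2 + Real.log (1 / δ) := by
    rw [← h2]; simpa using h1
  have h4 : Real.log 2 ≤ 1 := by linarith [Real.log_two_lt_d9]
  have h5 : (p : ℝ) * Real.log 2 ≤ p := mul_le_of_le_one_right (Nat.cast_nonneg p) h4
  have h6 : Real.sqrt (q * τ * n) = l * (τ * n) := by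
    rw [Real.sqrt_eq_iff_mul_self_eq_of_pos (by positivity)]
    linear_combination (τ * n) * hl2
  rw [h6]
  refine le_of_mul_le_mul_left ?_ hl0
  linarith

/-- The vector of the inner products of `v` with the members of a family `z`; as a function of `v`,
the linear map whose matrix has the rows `zᵢ`. -/
noncomputable def innerVec (z : Fin n → EuclideanSpace ℝ (Fin p)) (v : EuclideanSpace ℝ (Fin p)) :
    EuclideanSpace ℝ (Fin n) :=
  WithLp.toLp 2 fun i => inner ℝ v (z i)

lemma innerVec_add (z : Fin n → EuclideanSpace ℝ (Fin p)) (v w : EuclideanSpace ℝ (Fin p)) :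
    innerVec z (v + w) = innerVec z v + innerVec z w := by
  ext i; simp [innerVec, inner_add_left]

lemma innerVec_smul (z : Fin n → EuclideanSpace ℝ (Fin p)) (c : ℝ)
    (v : EuclideanSpace ℝ (Fin p)) : innerVec z (c • v) = c • innerVec z v := by
  ext i; simp [innerVec, inner_smul_left]

lemma norm_innerVec_sq (z : Fin n → EuclideanSpace ℝ (Fin p)) (v : EuclideanSpace ℝ (Fin p)) :
    ‖innerVec z v‖ ^ 2 = ∑ i, inner ℝ v (z i) ^ 2 := by
  rw [EuclideanSpace.norm_sq_eq]; simp [innerVec]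

/-- Concentration of the operator norm of the `n × p` matrix with rows `ξᵢ`. The bilinear process
`exp (λ ∑ aᵢ ⟨u, ξᵢ⟩)` is averaged first over `a` in the unit ball of `ℝⁿ`, which controls
`exp ((λ / 2) ‖innerVec ξ u‖)` for each `u`, and then over `u` in the unit ball of `ℝᵖ`. -/
lemma measure_sum_inner_sq_gt_le [SFinite P] (hτ : 0 < τ) (hn : 0 < n) (hpn : p ≤ n)
    (hξ : ∀ i, IsSubGaussianVector P τ (ξ i)) (hind : iIndepFun ξ P)
    {δ : ℝ} (hδ : 0 < δ) (hδn : Real.log (1 / δ) ≤ n) :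
    P {ω | ¬ ∀ v, ∑ i, inner ℝ v (ξ i ω) ^ 2 ≤ 196 * τ * n * ‖v‖ ^ 2} ≤ ENNReal.ofReal δ := by
  have hn' : (0 : ℝ) < n := by exact_mod_cast hn
  have hpn' : (p : ℝ) ≤ n := by exact_mod_cast hpn
  -- this value of the exponent makes `τ l² / 2` of order `n`
  set l := Real.sqrt (n / τ) with hl
  have hl0 : 0 < l := Real.sqrt_pos.2 (by positivity)
  have hl2 : l ^ 2 * τ = n := by
    rw [hl, Real.sq_sqrt (by positivity)]; field_simp
  have hξm := fun i => (hξ i).measurable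
  have hpoint : ∀ u, ‖u‖ ≤ 1 →
      ∫⁻ ω, ENNReal.ofReal (Real.exp (l / 2 * ‖innerVec (fun i => ξ i ω) u‖)) ∂P ≤
        ENNReal.ofReal (Real.exp (n * Real.log 2 + n / 2)) := by
    intro u hu
    obtain ⟨Φ, hΦ, hΦi, hΦl⟩ := exists_lintegral_le_and_exp_half_le P
      (F := fun ω (a : EuclideanSpace ℝ (Fin n)) => l * ∑ i, a i * inner ℝ u (ξ i ω))
      (M := ENNReal.ofReal (Real.exp (n / 2)))
      (by unfold Function.uncurry; fun_prop)
      (fun ω c h => by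
        simp only [PiLp.add_apply, PiLp.sub_apply, add_mul, sub_mul, Finset.sum_add_distrib,
          Finset.sum_sub_distrib]
        linarith)
      (fun a ha => by
        have h1 := lintegral_exp_sum_inner_le hξ hind fun i => (l * a i) • u
        simp only [inner_smul_left, conj_trivial, mul_assoc, ← Finset.mul_sum] at h1
        refine h1.trans (ENNReal.ofReal_le_ofReal (Real.exp_le_exp.2 ?_))
        have h2 : ∑ i, ‖(l * a i) • u‖ ^ 2 = l ^ 2 * ‖u‖ ^ 2 * ‖a‖ ^ 2 := by
          rw [EuclideanSpace.norm_sq_eq a, Finset.mul_sum]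
          refine Finset.sum_congr rfl fun i _ => ?_
          rw [norm_smul, norm_mul, mul_pow, mul_pow, Real.norm_eq_abs, sq_abs]
          ring
        have h3 : ‖u‖ ^ 2 * ‖a‖ ^ 2 ≤ 1 :=
          mul_le_one₀ (pow_le_one₀ (norm_nonneg _) hu) (by positivity)
            (pow_le_one₀ (norm_nonneg _) ha)
        calc τ / 2 * ∑ i, ‖(l * a i) • u‖ ^ 2 = (l ^ 2 * τ) * (‖u‖ ^ 2 * ‖a‖ ^ 2) / 2 := by
              rw [h2]; ring
          _ ≤ n / 2 := by rw [hl2]; nlinarith)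
    rw [two_pow_mul_ofReal_exp, finrank_euclideanSpace_fin] at hΦi
    refine (lintegral_mono fun ω => ?_).trans hΦi
    set y := innerVec (fun i => ξ i ω) u with hy
    have h1 := hΦl ω (‖y‖⁻¹ • y) (by
      rw [norm_smul, norm_inv, norm_norm]; exact inv_mul_le_one)
    refine le_trans (le_of_eq ?_) h1
    congr 2
    have h2 : ∑ i, y i * inner ℝ u (ξ i ω) = ‖y‖ ^ 2 := by
      rw [norm_innerVec_sq]
      exact Finset.sum_congr rfl fun i _ => by simp [hy, innerVec, sq]
    simp only [PiLp.smul_apply, smul_eq_mul, mul_assoc, ← Finset.mul_sum, h2]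
    by_cases hy0 : ‖y‖ = 0
    · simp [hy0]
    · field_simp
  obtain ⟨Φ, hΦ, hΦi, hΦl⟩ := exists_lintegral_le_and_exp_half_le P
    (F := fun ω u => l / 2 * ‖innerVec (fun i => ξ i ω) u‖)
    (by unfold Function.uncurry innerVec; fun_prop)
    (fun ω c h => by
      have h1 := norm_add_le (innerVec (fun i => ξ i ω) (c + h)) (innerVec (fun i => ξ i ω) (c - h))
      rw [← innerVec_add, show c + h + (c - h) = (2 : ℝ) • c by rw [two_smul]; abel,
        innerVec_smul, norm_smul, Real.norm_ofNat] at h1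
      have := mul_le_mul_of_nonneg_left h1 hl0.le
      linarith) hpoint
  rw [two_pow_mul_ofReal_exp, finrank_euclideanSpace_fin] at hΦi
  refine (measure_mono fun ω hω => ?_).trans (measure_gt_le_of_lintegral_le hΦ hδ hΦi)
  refine fun hle => hω fun v => ?_
  have h4 : Real.log 2 ≤ 1 := by linarith [Real.log_two_lt_d9]
  have h5 : (p : ℝ) * Real.log 2 ≤ n :=
    (mul_le_of_le_one_right (Nat.cast_nonneg p) h4).trans hpn'
  have h6 : (n : ℝ) * Real.log 2 ≤ n := mul_le_of_le_one_right hn'.le h4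
  have hunit : ∀ v, ‖v‖ ≤ 1 → ‖innerVec (fun i => ξ i ω) v‖ ≤ 14 * (l * τ) := by
    intro v hv
    have h1 := (hΦl ω v hv).trans hle
    rw [ENNReal.ofReal_le_ofReal_iff (Real.exp_nonneg _), Real.exp_le_exp, innerVec_smul,
      norm_smul] at h1
    norm_num at h1
    have h7 : Real.log (1 / δ) = -Real.log δ := by rw [one_div, Real.log_inv]
    refine le_of_mul_le_mul_left ?_ hl0
    linarith
  rw [← norm_innerVec_sq]
  have h8 : ‖innerVec (fun i => ξ i ω) v‖ ≤ 14 * (l * τ) * ‖v‖ := by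
    by_cases hv : v = 0
    · have h0 := innerVec_smul (fun i => ξ i ω) 0 0
      rw [zero_smul, zero_smul] at h0
      simp [hv, h0]
    have hv' : 0 < ‖v‖ := norm_pos_iff.2 hv
    have h9 := hunit (‖v‖⁻¹ • v) (by
      rw [norm_smul, norm_inv, norm_norm, inv_mul_cancel₀ hv'.ne'])
    rw [innerVec_smul, norm_smul, norm_inv, norm_norm, inv_mul_le_iff₀ hv'] at h9
    linarith
  calc ‖innerVec (fun i => ξ i ω) v‖ ^ 2 ≤ (14 * (l * τ) * ‖v‖) ^ 2 := by gcongr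
    _ = 196 * τ * (l ^ 2 * τ) * ‖v‖ ^ 2 := by ring
    _ = _ := by rw [hl2]

end Concentration

/-! ### The largest eigenvalue and the reweighting cost -/

section Cost

variable {n p : ℕ}

/-- Variational characterization of the largest eigenvalue. -/
lemma lambdaMax_le_iff (hp : 0 < p) {M : Matrix (Fin p) (Fin p) ℝ} (hM : M.IsHermitian) (c : ℝ) :
    lambdaMax M ≤ c ↔
      ∀ v : EuclideanSpace ℝ (Fin p), v.ofLp ⬝ᵥ M.mulVec v.ofLp ≤ c * ‖v‖ ^ 2 := by
  have hne : (spectrum ℝ M).Nonempty := by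
    rw [hM.spectrum_real_eq_range_eigenvalues]
    exact ⟨_, ⟨0, hp⟩, rfl⟩
  have hfin : (spectrum ℝ M).Finite := Matrix.finite_real_spectrum
  have h1 : lambdaMax M ≤ c ↔ ∀ x ∈ spectrum ℝ M, x ≤ c := csSup_le_iff hfin.bddAbove hne
  rw [h1, ← le_algebraMap_iff_spectrum_le (a := M) (ha := hM), Matrix.le_iff,
    Matrix.posSemidef_iff_dotProduct_mulVec]
  have hH : (algebraMap ℝ (Matrix (Fin p) (Fin p) ℝ) c - M).IsHermitian := by
    refine Matrix.IsHermitian.sub ?_ hM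
    rw [Matrix.algebraMap_eq_diagonal]
    exact Matrix.isHermitian_diagonal _
  have key : ∀ v : Fin p → ℝ,
      star v ⬝ᵥ (algebraMap ℝ (Matrix (Fin p) (Fin p) ℝ) c - M).mulVec v =
        c * ‖(WithLp.toLp 2 v : EuclideanSpace ℝ (Fin p))‖ ^ 2 - v ⬝ᵥ M.mulVec v := by
    intro v
    rw [Matrix.sub_mulVec, dotProduct_sub, EuclideanSpace.norm_sq_eq, Algebra.algebraMap_eq_smul_one,
      Matrix.smul_mulVec, Matrix.one_mulVec, dotProduct_smul]
    simp [dotProduct, sq]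
  refine ⟨fun h v => ?_, fun h => ⟨hH, fun v => ?_⟩⟩
  · have := h.2 v.ofLp
    rw [key] at this
    simpa using this
  · rw [key]
    have := h (WithLp.toLp 2 v)
    simpa using this

lemma dotProduct_sum_tensorSq_mulVec (w : Fin n → ℝ) (z : Fin n → EuclideanSpace ℝ (Fin p))
    (v : EuclideanSpace ℝ (Fin p)) :
    v.ofLp ⬝ᵥ (∑ i, w i • tensorSq (z i)).mulVec v.ofLp = ∑ i, w i * inner ℝ v (z i) ^ 2 := by
  rw [Matrix.sum_mulVec, dotProduct_sum]
  refine Finset.sum_congr rfl fun i _ => ?_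
  have h : inner ℝ v (z i) = (z i).ofLp ⬝ᵥ v.ofLp := by
    rw [EuclideanSpace.inner_eq_star_dotProduct]; simp
  rw [Matrix.smul_mulVec, dotProduct_smul, tensorSq, Matrix.vecMulVec_mulVec, h, smul_eq_mul]
  simp [dotProduct_comm, sq]

lemma weightCost_le_iff (hp : 0 < p) (x : Fin n → EuclideanSpace ℝ (Fin p))
    (m : EuclideanSpace ℝ (Fin p)) (w : Fin n → ℝ) (c : ℝ) :
    weightCost x m w ≤ c ↔ ∀ v, ∑ i, w i * inner ℝ v (x i - m) ^ 2 ≤ c * ‖v‖ ^ 2 := by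
  have hH : (∑ i, w i • tensorSq (x i - m)).IsHermitian := by
    ext j k
    simp only [Matrix.conjTranspose_apply, Matrix.sum_apply, Matrix.smul_apply, tensorSq,
      Matrix.vecMulVec_apply, star_trivial, mul_comm]
  rw [weightCost, lambdaMax_le_iff hp hH]
  simp_rw [dotProduct_sum_tensorSq_mulVec]

lemma sum_mul_inner_sq_le_weightCost (hp : 0 < p) (x : Fin n → EuclideanSpace ℝ (Fin p))
    (m : EuclideanSpace ℝ (Fin p)) (w : Fin n → ℝ) (v : EuclideanSpace ℝ (Fin p)) :
    ∑ i, w i * inner ℝ v (x i - m) ^ 2 ≤ weightCost x m w * ‖v‖ ^ 2 :=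
  (weightCost_le_iff hp x m w _).1 le_rfl v

end Cost

/-! ### Existence of the minimizers -/

section Existence

variable {n p : ℕ}

lemma exists_isGeometricMedian (hn : 0 < n) (x : Fin n → EuclideanSpace ℝ (Fin p)) :
    ∃ m, IsGeometricMedian x m := by
  refine Continuous.exists_forall_le (f := fun m => ∑ i, ‖x i - m‖) (by fun_prop) ?_
  refine Filter.tendsto_atTop_mono (f := fun m => ‖m‖ - ‖x ⟨0, hn⟩‖) (fun m => ?_)
    (Filter.tendsto_atTop_add_const_right _ _ tendsto_norm_cocompact_atTop)
  have h1 : ‖x ⟨0, hn⟩ - m‖ ≤ ∑ i, ‖x i - m‖ :=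
    Finset.single_le_sum (f := fun i => ‖x i - m‖) (fun i _ => norm_nonneg _) (Finset.mem_univ _)
  have h2 := norm_sub_norm_le m (x ⟨0, hn⟩)
  rw [norm_sub_rev] at h2
  linarith

lemma exists_isReweightingStep (hp : 0 < p) (hn : 0 < n) {ε : ℝ} (hε : 0 < ε)
    (x : Fin n → EuclideanSpace ℝ (Fin p)) (m : EuclideanSpace ℝ (Fin p)) :
    ∃ m', IsReweightingStep ε x m m' := by
  have hn' : (0 : ℝ) < n := by exact_mod_cast hn
  have hcomp : IsCompact (feasibleWeights n ε) := by
    refine (isCompact_stdSimplex ℝ (Fin n)).inter_right ?_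
    exact isClosed_le (f := fun w : Fin n → ℝ => ((n : ℝ) - n * ε) * ‖w‖) (by fun_prop)
      continuous_const
  have hne : (feasibleWeights n ε).Nonempty := by
    refine ⟨fun _ => (n : ℝ)⁻¹, ⟨fun _ => by positivity, by simp [hn'.ne']⟩, ?_⟩
    have : Nonempty (Fin n) := ⟨⟨0, hn⟩⟩
    rw [pi_norm_const, norm_inv, Real.norm_natCast]
    have : ((n : ℝ) - n * ε) * (n : ℝ)⁻¹ = 1 - ε := by field_simp
    linarith
  have hlsc : LowerSemicontinuous (weightCost x m) := by
    rw [lowerSemicontinuous_iff_isClosed_preimage]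
    intro c
    have : weightCost x m ⁻¹' Set.Iic c =
        ⋂ v, {w | ∑ i, w i * inner ℝ v (x i - m) ^ 2 ≤ c * ‖v‖ ^ 2} := by
      ext w; simp [weightCost_le_iff hp]
    rw [this]
    exact isClosed_iInter fun v => isClosed_le (by fun_prop) continuous_const
  obtain ⟨w, hw, hmin⟩ := (hlsc.lowerSemicontinuousOn _).exists_isMinOn hne hcomp
  exact ⟨_, w, hw, hmin, rfl⟩

lemma exists_isIterativelyReweightedMean (hp : 0 < p) (hn : 0 < n) {ε : ℝ} (hε : 0 < ε)
    (x : Fin n → EuclideanSpace ℝ (Fin p)) : ∃ m, IsIterativelyReweightedMean ε x m := by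
  obtain ⟨m₀, hm₀⟩ := exists_isGeometricMedian hn x
  choose f hf using exists_isReweightingStep hp hn hε x
  exact ⟨_, fun k => f^[k] m₀, hm₀,
    fun k _ => by beta_reduce; rw [Function.iterate_succ_apply']; exact hf _, rfl⟩

end Existence

/-! ### The square root of the covariance matrix -/

section SquareRoot

variable {p : ℕ} {S : Matrix (Fin p) (Fin p) ℝ}

lemma inner_sqrtApply (v y : EuclideanSpace ℝ (Fin p)) :
    inner ℝ v (sqrtApply S y) = inner ℝ (sqrtApply S v) y := by
  have hH : (CFC.sqrt S).IsHermitian :=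
    (Matrix.nonneg_iff_posSemidef.1 (CFC.sqrt_nonneg S)).isHermitian
  have hsa : IsSelfAdjoint (Matrix.toEuclideanCLM (n := Fin p) (𝕜 := ℝ) (CFC.sqrt S)) :=
    IsSelfAdjoint.map (show IsSelfAdjoint (CFC.sqrt S) from hH) _
  exact (hsa.isSymmetric v y).symm

lemma norm_sqrtApply_le (hS : S.PosSemidef) (v : EuclideanSpace ℝ (Fin p)) :
    ‖sqrtApply S v‖ ≤ Real.sqrt (opNorm S) * ‖v‖ := by
  have h1 : sqrtApply S (sqrtApply S v) = Matrix.toEuclideanCLM (n := Fin p) (𝕜 := ℝ) S v := by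
    have h2 : CFC.sqrt S * CFC.sqrt S = S :=
      CFC.sqrt_mul_sqrt_self S (Matrix.nonneg_iff_posSemidef.2 hS)
    conv_rhs => rw [← h2, map_mul]
    rfl
  have h3 : ‖sqrtApply S v‖ ^ 2 ≤ opNorm S * ‖v‖ ^ 2 := by
    rw [← real_inner_self_eq_norm_sq, ← inner_sqrtApply, h1]
    refine (real_inner_le_norm _ _).trans ?_
    have := (Matrix.toEuclideanCLM (n := Fin p) (𝕜 := ℝ) S).le_opNorm v
    rw [opNorm]
    nlinarith [norm_nonneg v]
  have h0 : 0 ≤ opNorm S := norm_nonneg _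
  refine abs_le_of_sq_le_sq' ?_ (by positivity) |>.2
  rwa [mul_pow, Real.sq_sqrt h0]

end SquareRoot

/-! ### Weights of the inliers and of the outliers -/

section Weights

variable {n p : ℕ} {ε : ℝ} {w : Fin n → ℝ} {I : Finset (Fin n)}

lemma mul_apply_le_one_of_mem_feasibleWeights (hε : ε < 1) (hw : w ∈ feasibleWeights n ε)
    (i : Fin n) : n * (1 - ε) * w i ≤ 1 := by
  have h1 : w i ≤ ‖w‖ := (le_abs_self _).trans (norm_le_pi_norm w i)
  have h2 : (0 : ℝ) ≤ n * (1 - ε) := mul_nonneg (Nat.cast_nonneg n) (by linarith)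
  calc n * (1 - ε) * w i ≤ n * (1 - ε) * ‖w‖ := by gcongr
    _ = ((n : ℝ) - n * ε) * ‖w‖ := by ring
    _ ≤ 1 := hw.2

lemma sum_compl_le_of_mem_feasibleWeights (hn : 0 < n) (hε : ε < 1)
    (hI : n * (1 - ε) ≤ (I.card : ℝ)) (hw : w ∈ feasibleWeights n ε) :
    ∑ i ∈ Iᶜ, w i ≤ ε / (1 - ε) := by
  have hn' : (0 : ℝ) < n := by exact_mod_cast hn
  have ha : 0 < 1 - ε := by linarith
  have hc : ((Iᶜ.card : ℕ) : ℝ) = n - I.card := by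
    rw [Finset.card_compl, Fintype.card_fin, Nat.cast_sub (by simpa using I.card_le_univ)]
  calc ∑ i ∈ Iᶜ, w i ≤ ∑ _i ∈ Iᶜ, 1 / (n * (1 - ε)) := Finset.sum_le_sum fun i _ => by
        rw [le_div_iff₀' (by positivity)]; exact mul_apply_le_one_of_mem_feasibleWeights hε hw i
    _ = (n - I.card) * (1 / (n * (1 - ε))) := by rw [Finset.sum_const, nsmul_eq_mul, hc]
    _ ≤ (n * ε) * (1 / (n * (1 - ε))) := by gcongr; linarith
    _ = ε / (1 - ε) := by field_simp

/-- Feasible weights restricted to the inliers are close in `ℓ¹` to a multiple of the uniform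
weights, so a weighted sum over the inliers deviates little from the sum over the whole sample. -/
lemma abs_sum_mul_le_of_mem_feasibleWeights (hn : 0 < n) (hε0 : 0 < ε) (hε : ε < 1)
    (hI : n * (1 - ε) ≤ (I.card : ℝ)) (hw : w ∈ feasibleWeights n ε) {b : Fin n → ℝ} {Q R : ℝ}
    (hQ : 0 ≤ Q) (hb : ∑ i, b i ^ 2 ≤ n * Q ^ 2) (hR : |∑ i, b i| ≤ n * R) :
    |∑ i ∈ I, w i * b i| ≤ (∑ i ∈ I, w i) * R + 2 * Real.sqrt ε * Q / (1 - ε) := by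
  have hn' : (0 : ℝ) < n := by exact_mod_cast hn
  have ha : 0 < 1 - ε := by linarith
  set W := ∑ i ∈ I, w i with hW
  have hwnn : ∀ i, 0 ≤ w i := hw.1.1
  have hW0 : 0 ≤ W := Finset.sum_nonneg fun i _ => hwnn i
  have hWc : W + ∑ i ∈ Iᶜ, w i = 1 := by rw [hW, Finset.sum_add_sum_compl]; exact hw.1.2
  have hOnn : 0 ≤ ∑ i ∈ Iᶜ, w i := Finset.sum_nonneg fun i _ => hwnn i
  have hO := sum_compl_le_of_mem_feasibleWeights hn hε hI hw
  set c := 1 / (n * (1 - ε)) with hc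
  have hc0 : 0 < c := by positivity
  have hwc : ∀ i, w i ≤ c := fun i => by
    rw [hc, le_div_iff₀' (by positivity)]; exact mul_apply_le_one_of_mem_feasibleWeights hε hw i
  set t : Fin n → ℝ := fun i => (if i ∈ I then w i else 0) - W / n with ht
  have hif : ∀ i, (0 ≤ if i ∈ I then w i else 0) ∧ (if i ∈ I then w i else 0) ≤ c := fun i => by
    split_ifs
    · exact ⟨hwnn i, hwc i⟩
    · exact ⟨le_rfl, hc0.le⟩
  have hWn0 : 0 ≤ W / n := by positivity
  have hWn : W / n ≤ c := by
    rw [hc, div_le_div_iff₀ hn' (by positivity), one_mul]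
    calc W * (n * (1 - ε)) ≤ 1 * (n * 1) := by gcongr <;> linarith
      _ = n := by ring
  -- the gap between the cap on a weight and the average inlier weight
  have hgap : c - W / n ≤ 2 * ε * c := by
    have : (1 - 2 * ε) / (1 - ε) ≤ W := by
      have : 1 - ε / (1 - ε) = (1 - 2 * ε) / (1 - ε) := by field_simp; ring
      linarith
    have h2 : (1 - 2 * ε) * c ≤ W / n := by
      calc (1 - 2 * ε) * c = ((1 - 2 * ε) / (1 - ε)) / n := by rw [hc]; field_simp
        _ ≤ W / n := by gcongr
    linarith
  have htsum : ∑ i, t i = 0 := by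
    simp only [ht, Finset.sum_sub_distrib, Finset.sum_ite_mem, Finset.univ_inter, ← hW,
      Finset.sum_const, Finset.card_univ, Fintype.card_fin, nsmul_eq_mul]
    field_simp; ring
  have htabs : ∀ i, |t i| ≤ 4 * ε * c - t i := fun i => by
    have h1 := (hif i).2
    have h2 : t i ≤ 2 * ε * c := by simp only [ht]; linarith
    have h3 : 0 ≤ 2 * ε * c := by positivity
    rcases abs_cases (t i) with h | h <;> linarith
  have htc : ∀ i, |t i| ≤ c := fun i => by
    have h1 := hif i
    rw [abs_le]; simp only [ht]
    constructor <;> linarith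
  have htl1 : ∑ i, |t i| ≤ 4 * ε / (1 - ε) := by
    calc ∑ i, |t i| ≤ ∑ i, (4 * ε * c - t i) := Finset.sum_le_sum fun i _ => htabs i
      _ = 4 * ε / (1 - ε) := by
        rw [Finset.sum_sub_distrib, htsum, Finset.sum_const, Finset.card_univ, Fintype.card_fin,
          nsmul_eq_mul, hc]
        field_simp; ring
  have htb : |∑ i, t i * b i| ≤ 2 * Real.sqrt ε * Q / (1 - ε) := by
    refine abs_le_of_sq_le_sq ?_ (by positivity)
    calc (∑ i, t i * b i) ^ 2 ≤ (∑ i, |t i|) * ∑ i, |t i| * b i ^ 2 :=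
          Finset.sum_sq_le_sum_mul_sum_of_sq_le_mul _ (fun i _ => abs_nonneg _)
            (fun i _ => by positivity) fun i _ => by
              rw [mul_pow, ← sq_abs (t i)]; exact (by ring : _ = _).le
      _ ≤ (4 * ε / (1 - ε)) * (c * (n * Q ^ 2)) := by
          gcongr
          calc ∑ i, |t i| * b i ^ 2 ≤ ∑ i, c * b i ^ 2 :=
                Finset.sum_le_sum fun i _ => by gcongr; exact htc i
            _ = c * ∑ i, b i ^ 2 := by rw [Finset.mul_sum]
            _ ≤ c * (n * Q ^ 2) := by gcongr
      _ = (2 * Real.sqrt ε * Q / (1 - ε)) ^ 2 := by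
          rw [div_pow, mul_pow, mul_pow, Real.sq_sqrt hε0.le, hc]
          field_simp; ring
  have hdec : ∑ i ∈ I, w i * b i = W / n * ∑ i, b i + ∑ i, t i * b i := by
    simp only [ht, sub_mul, Finset.sum_sub_distrib, ite_mul, zero_mul, Finset.sum_ite_mem,
      Finset.univ_inter, ← Finset.mul_sum]
    ring
  rw [hdec]
  refine (abs_add_le _ _).trans (add_le_add ?_ htb)
  rw [abs_mul, abs_of_nonneg hWn0]
  calc W / n * |∑ i, b i| ≤ W / n * (n * R) := by gcongr
    _ = W * R := by field_simp

end Weights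

/-! ### Contraction of the reweighting step -/

section Contraction

variable {n p : ℕ} {ε B R : ℝ} {I : Finset (Fin n)} {x ζ : Fin n → EuclideanSpace ℝ (Fin p)}
  {μ m m' : EuclideanSpace ℝ (Fin p)}

/-- The minimal cost is at most the cost of the uniform weights on the inliers. -/
lemma weightCost_le_of_isMinOn (hp : 0 < p) (hn : 0 < n) (hε : ε < 1)
    (hI : n * (1 - ε) ≤ (I.card : ℝ)) (hx : ∀ i ∈ I, x i - μ = ζ i) (hB0 : 0 ≤ B)
    (hB : ∀ v, ∑ i, inner ℝ v (ζ i) ^ 2 ≤ n * (B * ‖v‖) ^ 2) {w : Fin n → ℝ}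
    (hmin : IsMinOn (weightCost x m) (feasibleWeights n ε) w) :
    weightCost x m w ≤ (B / Real.sqrt (1 - ε) + ‖m - μ‖) ^ 2 := by
  have hn' : (0 : ℝ) < n := by exact_mod_cast hn
  have ha : 0 < 1 - ε := by linarith
  set k : ℝ := (I.card : ℝ) with hk
  have hk0 : 0 < k := lt_of_lt_of_le (by positivity) hI
  set u : Fin n → ℝ := fun i => if i ∈ I then k⁻¹ else 0 with hu
  have huf : u ∈ feasibleWeights n ε := by
    refine ⟨⟨fun i => ?_, ?_⟩, ?_⟩
    · simp only [hu]; split_ifs <;> positivity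
    · simp only [hu, Finset.sum_ite_mem, Finset.univ_inter, Finset.sum_const, nsmul_eq_mul, ← hk]
      field_simp
    · have h1 : ‖u‖ ≤ k⁻¹ := (pi_norm_le_iff_of_nonneg (by positivity)).2 fun i => by
        simp only [hu]
        split_ifs
        · rw [Real.norm_of_nonneg (by positivity)]
        · rw [norm_zero]; positivity
      calc ((n : ℝ) - n * ε) * ‖u‖ = n * (1 - ε) * ‖u‖ := by ring
        _ ≤ k * k⁻¹ := by gcongr
        _ = 1 := mul_inv_cancel₀ hk0.ne'
  refine (hmin huf).trans ((weightCost_le_iff hp x m u _).2 fun v => ?_)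
  set c := inner ℝ v (m - μ) with hc
  set Q := B / Real.sqrt (1 - ε) * ‖v‖ with hQ
  have hQ0 : 0 ≤ Q := by positivity
  have hcv : |c| ≤ ‖m - μ‖ * ‖v‖ := by
    rw [mul_comm]; exact abs_real_inner_le_norm _ _
  have hsq : ∑ i ∈ I, inner ℝ v (ζ i) ^ 2 ≤ k * Q ^ 2 := by
    calc ∑ i ∈ I, inner ℝ v (ζ i) ^ 2 ≤ ∑ i, inner ℝ v (ζ i) ^ 2 :=
          Finset.sum_le_sum_of_subset_of_nonneg (Finset.subset_univ _) fun _ _ _ => sq_nonneg _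
      _ ≤ n * (B * ‖v‖) ^ 2 := hB v
      _ = n * (1 - ε) * Q ^ 2 := by
          rw [hQ, mul_pow, mul_pow (B / _), div_pow, Real.sq_sqrt ha.le]; field_simp
      _ ≤ k * Q ^ 2 := by gcongr
  have hlin : |∑ i ∈ I, inner ℝ v (ζ i)| ≤ k * Q := by
    refine abs_le_of_sq_le_sq ?_ (by positivity)
    calc (∑ i ∈ I, inner ℝ v (ζ i)) ^ 2 ≤ k * ∑ i ∈ I, inner ℝ v (ζ i) ^ 2 :=
          sq_sum_le_card_mul_sum_sq
      _ ≤ k * (k * Q ^ 2) := by gcongr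
      _ = (k * Q) ^ 2 := by ring
  calc ∑ i, u i * inner ℝ v (x i - m) ^ 2
      = k⁻¹ * ∑ i ∈ I, (inner ℝ v (ζ i) - c) ^ 2 := by
        simp only [hu, ite_mul, zero_mul, Finset.sum_ite_mem, Finset.univ_inter, ← Finset.mul_sum]
        congr 1
        refine Finset.sum_congr rfl fun i hi => ?_
        rw [hc, ← inner_sub_right, ← hx i hi, sub_sub_sub_cancel_right]
    _ = k⁻¹ * (∑ i ∈ I, inner ℝ v (ζ i) ^ 2 - 2 * (c * ∑ i ∈ I, inner ℝ v (ζ i)) + k * c ^ 2) := by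
        simp only [sub_sq, Finset.sum_add_distrib, Finset.sum_sub_distrib, ← Finset.sum_mul,
          ← Finset.mul_sum, Finset.sum_const, nsmul_eq_mul, ← hk]
        ring
    _ ≤ k⁻¹ * (k * Q ^ 2 + 2 * (|c| * (k * Q)) + k * |c| ^ 2) := by
        have h1 : -(c * ∑ i ∈ I, inner ℝ v (ζ i)) ≤ |c| * (k * Q) := by
          refine (neg_le_abs _).trans ?_
          rw [abs_mul]
          gcongr
        rw [sq_abs]
        gcongr
        linarith
    _ = (Q + |c|) ^ 2 := by field_simp; ring
    _ ≤ (Q + ‖m - μ‖ * ‖v‖) ^ 2 := by gcongr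
    _ = _ := by rw [hQ]; ring

/-- One reweighting step contracts the error by the factor `√(ε(1-ε)) / (1-2ε)`, up to an additive
term. Tested against a direction `v`, the total weight `W` of the inliers times the new error is a
weighted sum of inlier noises plus the weighted sum over the outliers of `⟨v, xᵢ - m'⟩`; the latter
is controlled by Cauchy–Schwarz, the weight of the outliers and the minimal cost. -/
lemma IsReweightingStep.norm_sub_le (hp : 0 < p) (hn : 0 < n) (hε0 : 0 < ε) (hε : 0 < 1 - 2 * ε)
    (hI : n * (1 - ε) ≤ (I.card : ℝ)) (hx : ∀ i ∈ I, x i - μ = ζ i) (hB0 : 0 ≤ B)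
    (hB : ∀ v, ∑ i, inner ℝ v (ζ i) ^ 2 ≤ n * (B * ‖v‖) ^ 2) (hR : ‖∑ i, ζ i‖ ≤ n * R)
    (hstep : IsReweightingStep ε x m m') :
    ‖m' - μ‖ ≤ Real.sqrt (ε * (1 - ε)) / (1 - 2 * ε) * ‖m - μ‖ +
      (R + 3 * Real.sqrt ε * B / (1 - 2 * ε)) := by
  have hn' : (0 : ℝ) < n := by exact_mod_cast hn
  have ha : 0 < 1 - ε := by linarith
  have hε1 : ε < 1 := by linarith
  obtain ⟨w, hw, hmin, hm'⟩ := hstep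
  have hwnn : ∀ i, 0 ≤ w i := hw.1.1
  have hw1 : ∑ i, w i = 1 := hw.1.2
  set W := ∑ i ∈ I, w i with hW
  have hWc : W + ∑ i ∈ Iᶜ, w i = 1 := by rw [hW, Finset.sum_add_sum_compl]; exact hw1
  have hO := sum_compl_le_of_mem_feasibleWeights hn hε1 hI hw
  have hOnn : 0 ≤ ∑ i ∈ Iᶜ, w i := Finset.sum_nonneg fun i _ => hwnn i
  have hWl : (1 - 2 * ε) / (1 - ε) ≤ W := by
    have : 1 - ε / (1 - ε) = (1 - 2 * ε) / (1 - ε) := by field_simp; ring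
    linarith
  have hWpos : 0 < W := lt_of_lt_of_le (by positivity) hWl
  set s := Real.sqrt ε with hs
  set r := Real.sqrt (1 - ε) with hr
  have hs2 : s ^ 2 = ε := Real.sq_sqrt hε0.le
  have hr2 : r ^ 2 = 1 - ε := Real.sq_sqrt ha.le
  have hs0 : 0 < s := Real.sqrt_pos.2 hε0
  have hr0 : 0 < r := Real.sqrt_pos.2 ha
  set d := m' - μ with hd
  set G := B / r + ‖m - μ‖ with hG
  have hG0 : 0 ≤ G := by positivity
  have hcost := weightCost_le_of_isMinOn (m := m) hp hn hε1 hI hx hB0 hB hmin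
  -- the weighted second moment about `m` decreases when `m` is replaced by the weighted mean
  have hcentre : ∑ i, w i * inner ℝ d (x i - m') ^ 2 ≤ (G * ‖d‖) ^ 2 := by
    have h1 : ∑ i, w i * inner ℝ d (x i - m) = inner ℝ d (m' - m) := by
      simp only [inner_sub_right, mul_sub, Finset.sum_sub_distrib, ← Finset.sum_mul, hw1, one_mul,
        hm', inner_sum, inner_smul_right]
    have h2 : ∀ i, inner ℝ d (x i - m') = inner ℝ d (x i - m) - inner ℝ d (m' - m) := fun i => by
      rw [← inner_sub_right, sub_sub_sub_cancel_right]
    have h3 : ∑ i, w i * inner ℝ d (x i - m') ^ 2 =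
        ∑ i, w i * inner ℝ d (x i - m) ^ 2 - inner ℝ d (m' - m) ^ 2 := by
      have h4 : ∀ i, w i * inner ℝ d (x i - m') ^ 2 = w i * inner ℝ d (x i - m) ^ 2 -
          2 * inner ℝ d (m' - m) * (w i * inner ℝ d (x i - m)) +
          w i * inner ℝ d (m' - m) ^ 2 := fun i => by rw [h2 i]; ring
      simp only [h4, Finset.sum_add_distrib, Finset.sum_sub_distrib, ← Finset.mul_sum, h1,
        ← Finset.sum_mul, hw1]
      ring
    have h5 := sum_mul_inner_sq_le_weightCost hp x m w d
    have h6 : weightCost x m w * ‖d‖ ^ 2 ≤ G ^ 2 * ‖d‖ ^ 2 := by gcongr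
    rw [h3, mul_pow]
    linarith [sq_nonneg (inner ℝ d (m' - m))]
  have hout : ∑ i ∈ Iᶜ, w i * inner ℝ d (x i - m') ≤ s / r * (G * ‖d‖) := by
    refine (abs_le_of_sq_le_sq' ?_ (by positivity)).2
    calc (∑ i ∈ Iᶜ, w i * inner ℝ d (x i - m')) ^ 2
        ≤ (∑ i ∈ Iᶜ, w i) * ∑ i ∈ Iᶜ, w i * inner ℝ d (x i - m') ^ 2 :=
          Finset.sum_sq_le_sum_mul_sum_of_sq_le_mul _ (fun i _ => hwnn i)
            (fun i _ => mul_nonneg (hwnn i) (sq_nonneg _)) fun i _ => by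
              exact (by ring : _ = _).le
      _ ≤ (ε / (1 - ε)) * (G * ‖d‖) ^ 2 := by
          refine mul_le_mul hO (le_trans ?_ hcentre) (Finset.sum_nonneg fun i _ =>
            mul_nonneg (hwnn i) (sq_nonneg _)) (by positivity)
          exact Finset.sum_le_sum_of_subset_of_nonneg (Finset.subset_univ _)
            fun i _ _ => mul_nonneg (hwnn i) (sq_nonneg _)
      _ = (s / r * (G * ‖d‖)) ^ 2 := by rw [mul_pow (s / r), div_pow, hs2, hr2]
  have hnoise : |∑ i ∈ I, w i * inner ℝ d (ζ i)| ≤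
      W * (R * ‖d‖) + 2 * s * (B * ‖d‖) / (1 - ε) := by
    refine abs_sum_mul_le_of_mem_feasibleWeights hn hε0 hε1 hI hw (by positivity) (hB d) ?_
    rw [← inner_sum]
    calc |inner ℝ d (∑ i, ζ i)| ≤ ‖d‖ * ‖∑ i, ζ i‖ := abs_real_inner_le_norm _ _
      _ ≤ ‖d‖ * (n * R) := by gcongr
      _ = n * (R * ‖d‖) := by ring
  have hbalance : W * ‖d‖ ^ 2 =
      ∑ i ∈ I, w i * inner ℝ d (ζ i) + ∑ i ∈ Iᶜ, w i * inner ℝ d (x i - m') := by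
    have h1 : ∑ i, w i * inner ℝ d (x i - m') = 0 := by
      simp only [inner_sub_right, mul_sub, Finset.sum_sub_distrib, ← Finset.sum_mul, hw1, one_mul,
        hm', inner_sum, inner_smul_right, sub_self]
    rw [← Finset.sum_add_sum_compl I] at h1
    have h2 : ∑ i ∈ I, w i * inner ℝ d (x i - m') =
        ∑ i ∈ I, w i * inner ℝ d (ζ i) - W * ‖d‖ ^ 2 := by
      rw [hW, Finset.sum_mul, ← Finset.sum_sub_distrib]
      refine Finset.sum_congr rfl fun i hi => ?_
      rw [← hx i hi, ← real_inner_self_eq_norm_sq d, ← mul_sub, ← inner_sub_right, hd,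
        sub_sub_sub_cancel_right]
    linarith
  have hmain : W * ‖d‖ ^ 2 ≤
      (W * R + 2 * s * B / (1 - ε) + s / r * G) * ‖d‖ := by
    have h1 : 2 * s * (B * ‖d‖) / (1 - ε) = 2 * s * B / (1 - ε) * ‖d‖ := by ring
    rw [hbalance]
    linarith [le_abs_self (∑ i ∈ I, w i * inner ℝ d (ζ i))]
  have hR0 : 0 ≤ R := nonneg_of_mul_nonneg_right ((norm_nonneg _).trans hR) hn'
  have hmain' : W * ‖d‖ ≤ W * R + 2 * s * B / (1 - ε) + s / r * G := by
    by_cases hd0 : ‖d‖ = 0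
    · rw [hd0, mul_zero]; positivity
    · have : 0 < ‖d‖ := lt_of_le_of_ne (norm_nonneg _) (Ne.symm hd0)
      refine le_of_mul_le_mul_right ?_ this
      linarith
  have hsr : Real.sqrt (ε * (1 - ε)) = s * r := Real.sqrt_mul hε0.le _
  have hrest : 2 * s * B / (1 - ε) + s / r * G =
      (1 - 2 * ε) / (1 - ε) * (s * r / (1 - 2 * ε) * ‖m - μ‖ + 3 * s * B / (1 - 2 * ε)) := by
    rw [hG, ← hr2]
    field_simp
    ring
  rw [hsr]
  refine le_of_mul_le_mul_left ?_ hWpos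
  have hY : 0 ≤ s * r / (1 - 2 * ε) * ‖m - μ‖ + 3 * s * B / (1 - 2 * ε) := by positivity
  nlinarith [mul_le_mul_of_nonneg_right hWl hY]

end Contraction

/-! ### The geometric median -/

section Median

variable {n p : ℕ} {ε B : ℝ} {I : Finset (Fin n)} {x ζ : Fin n → EuclideanSpace ℝ (Fin p)}
  {μ m : EuclideanSpace ℝ (Fin p)}

lemma sum_norm_le_of_sum_inner_sq_le (hB0 : 0 ≤ B)
    (hB : ∀ v, ∑ i, inner ℝ v (ζ i) ^ 2 ≤ n * (B * ‖v‖) ^ 2) :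
    ∑ i, ‖ζ i‖ ≤ n * (B * Real.sqrt p) := by
  refine (abs_le_of_sq_le_sq' ?_ (by positivity)).2
  have h1 : ∑ i, ‖ζ i‖ ^ 2 ≤ p * (n * B ^ 2) := by
    calc ∑ i, ‖ζ i‖ ^ 2
        = ∑ j : Fin p, ∑ i, inner ℝ (EuclideanSpace.single j (1 : ℝ)) (ζ i) ^ 2 := by
          rw [Finset.sum_comm]
          refine Finset.sum_congr rfl fun i _ => ?_
          rw [EuclideanSpace.norm_sq_eq]
          simp [EuclideanSpace.inner_single_left]
      _ ≤ ∑ j : Fin p, n * (B * ‖EuclideanSpace.single j (1 : ℝ)‖) ^ 2 :=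
          Finset.sum_le_sum fun j _ => hB _
      _ = p * (n * B ^ 2) := by simp
  calc (∑ i, ‖ζ i‖) ^ 2 ≤ n * ∑ i, ‖ζ i‖ ^ 2 := by
        simpa using sq_sum_le_card_mul_sum_sq (s := Finset.univ) (f := fun i => ‖ζ i‖)
    _ ≤ n * (p * (n * B ^ 2)) := by gcongr
    _ = (n * (B * Real.sqrt p)) ^ 2 := by
        rw [mul_pow, mul_pow, Real.sq_sqrt (Nat.cast_nonneg p)]; ring

/-- The error of the geometric median is of order `√p`: passing from `μ` to `m` changes the sum of
the distances by at least `‖m - μ‖ - 2‖ζᵢ‖` for each inlier and `-‖m - μ‖` for each outlier. -/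
lemma IsGeometricMedian.norm_sub_le (hn : 0 < n) (hI : n * (1 - ε) ≤ (I.card : ℝ))
    (hx : ∀ i ∈ I, x i - μ = ζ i) (hB0 : 0 ≤ B)
    (hB : ∀ v, ∑ i, inner ℝ v (ζ i) ^ 2 ≤ n * (B * ‖v‖) ^ 2) (hm : IsGeometricMedian x m) :
    (1 - 2 * ε) * ‖m - μ‖ ≤ 2 * (B * Real.sqrt p) := by
  have hn' : (0 : ℝ) < n := by exact_mod_cast hn
  have hin : ∑ i ∈ I, (‖m - μ‖ - 2 * ‖ζ i‖) ≤ ∑ i ∈ I, (‖x i - m‖ - ‖x i - μ‖) := by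
    refine Finset.sum_le_sum fun i hi => ?_
    have h1 : ‖m - μ‖ ≤ ‖x i - μ‖ + ‖x i - m‖ := by
      rw [show m - μ = (x i - μ) - (x i - m) by abel]; exact _root_.norm_sub_le _ _
    rw [hx i hi] at *
    linarith
  have hout : ∑ i ∈ Iᶜ, (-‖m - μ‖) ≤ ∑ i ∈ Iᶜ, (‖x i - m‖ - ‖x i - μ‖) := by
    refine Finset.sum_le_sum fun i _ => ?_
    have h1 : ‖x i - μ‖ ≤ ‖x i - m‖ + ‖m - μ‖ := by
      rw [show x i - μ = (x i - m) + (m - μ) by abel]; exact norm_add_le _ _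
    linarith
  have htot : ∑ i ∈ I, (‖x i - m‖ - ‖x i - μ‖) + ∑ i ∈ Iᶜ, (‖x i - m‖ - ‖x i - μ‖) ≤ 0 := by
    rw [Finset.sum_add_sum_compl, Finset.sum_sub_distrib]
    linarith [hm μ]
  have hc : ((Iᶜ.card : ℕ) : ℝ) = n - I.card := by
    rw [Finset.card_compl, Fintype.card_fin, Nat.cast_sub (by simpa using I.card_le_univ)]
  rw [Finset.sum_const, nsmul_eq_mul, hc] at hout
  rw [Finset.sum_sub_distrib, Finset.sum_const, nsmul_eq_mul, ← Finset.mul_sum] at hin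
  have hζ : ∑ i ∈ I, ‖ζ i‖ ≤ n * (B * Real.sqrt p) :=
    (Finset.sum_le_sum_of_subset_of_nonneg (Finset.subset_univ _)
      fun _ _ _ => norm_nonneg _).trans (sum_norm_le_of_sum_inner_sq_le hB0 hB)
  refine le_of_mul_le_mul_left ?_ hn'
  nlinarith [norm_nonneg (m - μ)]

end Median

/-! ### Error of the iterated estimator -/

section Iteration

/-- The number of iterations is large enough for the contraction to absorb the factor `√p` in the
error of the geometric median. -/
lemma pow_numIterations_le {p : ℕ} (hp : 0 < p) {ε : ℝ} (hε0 : 0 < ε)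
    (hD : 0 < 1 - 2 * ε - Real.sqrt (ε * (1 - ε))) :
    (Real.sqrt (ε * (1 - ε)) / (1 - 2 * ε)) ^ numIterations p ε ≤
      ε * (1 - 2 * ε) / (2 * Real.sqrt p) := by
  have hp' : (0 : ℝ) < p := by exact_mod_cast hp
  have hb : 0 < 1 - 2 * ε := by linarith [Real.sqrt_nonneg (ε * (1 - ε))]
  have ha : 0 < 1 - ε := by linarith
  have hσ : 0 < Real.sqrt (ε * (1 - ε)) := Real.sqrt_pos.2 (by positivity)
  set α := Real.sqrt (ε * (1 - ε)) / (1 - 2 * ε) with hα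
  have hα0 : 0 < α := by positivity
  have hα1 : α < 1 := by rw [hα, div_lt_one hb]; linarith
  have hα2 : α ^ 2 = ε * (1 - ε) / (1 - 2 * ε) ^ 2 := by
    rw [hα, div_pow, Real.sq_sqrt (by positivity)]
  set L := 2 * Real.log (1 - 2 * ε) - Real.log ε - Real.log (1 - ε) with hL
  set N := Real.log (4 * p) - 2 * Real.log (ε * (1 - 2 * ε)) with hN
  have hlogα : Real.log (α ^ 2) = -L := by
    rw [hα2, Real.log_div (by positivity) (by positivity), Real.log_mul hε0.ne' ha.ne',
      Real.log_pow, hL]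
    push_cast; ring
  have hLpos : 0 < L := by
    have : Real.log (α ^ 2) < 0 := Real.log_neg (by positivity) (pow_lt_one₀ hα0.le hα1 (by norm_num))
    linarith
  have hK : N ≤ numIterations p ε * L := by
    rw [← div_le_iff₀ hLpos]; exact Nat.le_ceil _
  refine (abs_le_of_sq_le_sq' ?_ (by positivity)).2
  calc (α ^ numIterations p ε) ^ 2 = (α ^ 2) ^ numIterations p ε := by
        rw [← pow_mul, ← pow_mul, mul_comm]
    _ = Real.exp (-(numIterations p ε * L)) := by
        rw [← Real.exp_log (pow_pos (pow_pos hα0 2) (numIterations p ε)), Real.log_pow, hlogα]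
        congr 1; ring
    _ ≤ Real.exp (-N) := Real.exp_le_exp.2 (by linarith)
    _ = (ε * (1 - 2 * ε) / (2 * Real.sqrt p)) ^ 2 := by
        rw [hN, show -(Real.log (4 * p) - 2 * Real.log (ε * (1 - 2 * ε))) =
            Real.log ((ε * (1 - 2 * ε)) ^ 2) - Real.log (4 * p) by rw [Real.log_pow]; push_cast; ring,
          Real.exp_sub, Real.exp_log (by positivity), Real.exp_log (by positivity), div_pow,
          mul_pow 2, Real.sq_sqrt hp'.le]
        norm_num

lemma le_pow_mul_add_of_contraction {e : ℕ → ℝ} {α c : ℝ} (hα0 : 0 ≤ α) (hα1 : α < 1) {K : ℕ}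
    (h : ∀ k < K, e (k + 1) ≤ α * e k + c) (hc : 0 ≤ c) : e K ≤ α ^ K * e 0 + c / (1 - α) := by
  have h1 : 0 < 1 - α := by linarith
  suffices H : ∀ k ≤ K, e k ≤ α ^ k * e 0 + c / (1 - α) from H K le_rfl
  intro k
  induction k with
  | zero => intro _; have : 0 ≤ c / (1 - α) := by positivity
            simpa using this
  | succ k ih =>
    intro hk
    have h2 := mul_le_mul_of_nonneg_left (ih (by omega)) hα0
    have h3 : α * (c / (1 - α)) + c = c / (1 - α) := by field_simp; ring
    have h4 := h k (by omega)
    rw [pow_succ]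
    linarith

variable {n p : ℕ} {ε B R : ℝ} {I : Finset (Fin n)} {x ζ : Fin n → EuclideanSpace ℝ (Fin p)}
  {μ m : EuclideanSpace ℝ (Fin p)}

/-- The deterministic error bound: it holds for all data in which the noise of the inliers extends
to a family `ζ` with second moments at most `B²` in all directions and mean at most `R`. -/
lemma IsIterativelyReweightedMean.norm_sub_le (hp : 0 < p) (hn : 0 < n) (hε0 : 0 < ε)
    (hD : 0 < 1 - 2 * ε - Real.sqrt (ε * (1 - ε)))
    (hI : n * (1 - ε) ≤ (I.card : ℝ)) (hx : ∀ i ∈ I, x i - μ = ζ i) (hB0 : 0 ≤ B)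
    (hB : ∀ v, ∑ i, inner ℝ v (ζ i) ^ 2 ≤ n * (B * ‖v‖) ^ 2) (hR : ‖∑ i, ζ i‖ ≤ n * R)
    (hm : IsIterativelyReweightedMean ε x m) :
    ‖m - μ‖ ≤ (R + 4 * Real.sqrt ε * B) / (1 - 2 * ε - Real.sqrt (ε * (1 - ε))) := by
  have hn' : (0 : ℝ) < n := by exact_mod_cast hn
  have hp' : (0 : ℝ) < p := by exact_mod_cast hp
  set σ := Real.sqrt (ε * (1 - ε)) with hσ
  have hσ0 : 0 ≤ σ := Real.sqrt_nonneg _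
  have hb : 0 < 1 - 2 * ε := by linarith
  obtain ⟨est, h0, hstep, rfl⟩ := hm
  have hR0 : 0 ≤ R := nonneg_of_mul_nonneg_right ((norm_nonneg _).trans hR) hn'
  have hα0 : 0 ≤ σ / (1 - 2 * ε) := by positivity
  have hα1 : σ / (1 - 2 * ε) < 1 := by rw [div_lt_one hb]; linarith
  have hrec := le_pow_mul_add_of_contraction (e := fun k => ‖est k - μ‖) hα0 hα1
    (fun k hk => (hstep k hk).norm_sub_le hp hn hε0 hb hI hx hB0 hB hR) (by positivity)
  have hpow := pow_numIterations_le hp hε0 hD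
  have hmed := h0.norm_sub_le hn hI hx hB0 hB
  have hsp : 0 < Real.sqrt p := Real.sqrt_pos.2 hp'
  have hinit : (σ / (1 - 2 * ε)) ^ numIterations p ε * ‖est 0 - μ‖ ≤ ε * B := by
    calc _ ≤ ε * (1 - 2 * ε) / (2 * Real.sqrt p) * ‖est 0 - μ‖ := by gcongr
      _ = ε / (2 * Real.sqrt p) * ((1 - 2 * ε) * ‖est 0 - μ‖) := by ring
      _ ≤ ε / (2 * Real.sqrt p) * (2 * (B * Real.sqrt p)) := by gcongr
      _ = ε * B := by field_simp
  have hsq : ε ≤ Real.sqrt ε := Real.le_sqrt_of_sq_le (by nlinarith)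
  have hlim : (R + 3 * Real.sqrt ε * B / (1 - 2 * ε)) / (1 - σ / (1 - 2 * ε)) =
      ((1 - 2 * ε) * R + 3 * Real.sqrt ε * B) / (1 - 2 * ε - σ) := by
    rw [div_eq_div_iff (by linarith) hD.ne']
    field_simp
  refine hrec.trans ?_
  rw [hlim, le_div_iff₀ hD, add_mul, div_mul_cancel₀ _ hD.ne']
  have h1 : ε * B ≤ Real.sqrt ε * B := by gcongr
  have h2 : (σ / (1 - 2 * ε)) ^ numIterations p ε * ‖est 0 - μ‖ * (1 - 2 * ε - σ) ≤
      Real.sqrt ε * B * 1 := by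
    exact mul_le_mul (hinit.trans h1) (by linarith) hD.le (by positivity)
  have h3 : (1 - 2 * ε) * R ≤ R := mul_le_of_le_one_left hR0 (by linarith)
  linarith

end Iteration

/-! ### The high-probability bound -/

lemma one_sub_two_mul_sub_sqrt_pos {ε : ℝ} (hε : ε < (5 - Real.sqrt 5) / 10) :
    0 < 1 - 2 * ε - Real.sqrt (ε * (1 - ε)) := by
  have h5 : Real.sqrt 5 ^ 2 = 5 := Real.sq_sqrt (by norm_num)
  have h50 : 0 < Real.sqrt 5 := Real.sqrt_pos.2 (by norm_num)
  have hb : 0 < 1 - 2 * ε := by linarith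
  have : Real.sqrt (ε * (1 - ε)) < 1 - 2 * ε := by
    rw [Real.sqrt_lt' hb]
    -- the two roots of `1 - 5ε + 5ε²` are `(5 ± √5) / 10`
    nlinarith [mul_pos (sub_pos.2 hε)
      (show 0 < (5 + Real.sqrt 5) / 10 - ε by linarith)]
  linarith

section Deterministic

variable {n p : ℕ} {S : Matrix (Fin p) (Fin p) ℝ} {ξ : Fin n → EuclideanSpace ℝ (Fin p)}

lemma sum_inner_sqrtApply_sq_le (hS : S.PosSemidef) {c : ℝ} (hc : 0 ≤ c)
    (h : ∀ v, ∑ i, inner ℝ v (ξ i) ^ 2 ≤ c * ‖v‖ ^ 2) (v : EuclideanSpace ℝ (Fin p)) :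
    ∑ i, inner ℝ v (sqrtApply S (ξ i)) ^ 2 ≤ c * (Real.sqrt (opNorm S) * ‖v‖) ^ 2 := by
  simp_rw [inner_sqrtApply]
  refine (h _).trans ?_
  gcongr
  exact norm_sqrtApply_le hS v

lemma norm_sum_sqrtApply_le (hS : S.PosSemidef) :
    ‖∑ i, sqrtApply S (ξ i)‖ ≤ Real.sqrt (opNorm S) * ‖∑ i, ξ i‖ := by
  have : ∑ i, sqrtApply S (ξ i) = sqrtApply S (∑ i, ξ i) := by simp [sqrtApply]
  rw [this]
  exact norm_sqrtApply_le hS _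

/-- The deterministic bound in terms of the uncontaminated noise `ξ`, on the event where its second
moment matrix and its mean are controlled. -/
lemma norm_sub_le_of_sum_le (hp : 0 < p) (hn : 0 < n) {τ q ε : ℝ} (hτ : 0 < τ) (hq : 0 < q)
    (hε0 : 0 < ε) (hD : 0 < 1 - 2 * ε - Real.sqrt (ε * (1 - ε))) (hS : S.PosSemidef)
    {x : Fin n → EuclideanSpace ℝ (Fin p)} {μ m : EuclideanSpace ℝ (Fin p)}
    (hx : (({i : Fin n | x i ≠ μ + sqrtApply S (ξ i)}.ncard : ℕ) : ℝ) ≤ ε * n)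
    (hsq : ∀ v, ∑ i, inner ℝ v (ξ i) ^ 2 ≤ 196 * τ * n * ‖v‖ ^ 2)
    (hsum : ‖∑ i, ξ i‖ ≤ 3 * Real.sqrt (q * τ * n))
    (hm : IsIterativelyReweightedMean ε x m) :
    ‖m - μ‖ ≤ 28 * Real.sqrt τ * Real.sqrt (opNorm S) /
      (1 - 2 * ε - Real.sqrt (ε * (1 - ε))) * (Real.sqrt (q / n) + 3 * Real.sqrt ε) := by
  classical
  have hn' : (0 : ℝ) < n := by exact_mod_cast hn
  set s := Real.sqrt (opNorm S) with hs
  set a := Real.sqrt τ with ha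
  have ha2 : a ^ 2 = τ := Real.sq_sqrt hτ.le
  set I : Finset (Fin n) := {i | x i = μ + sqrtApply S (ξ i)} with hI
  have hcard : n * (1 - ε) ≤ (I.card : ℝ) := by
    have h1 : {i : Fin n | x i ≠ μ + sqrtApply S (ξ i)} = (Iᶜ : Finset (Fin n)) := by
      ext i; simp [hI]
    rw [h1, Set.ncard_coe_finset, Finset.card_compl, Fintype.card_fin,
      Nat.cast_sub (by simpa using I.card_le_univ)] at hx
    linarith
  have hin : ∀ i ∈ I, x i - μ = sqrtApply S (ξ i) := fun i hi => by
    rw [(Finset.mem_filter.1 hi).2, add_sub_cancel_left]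
  have hB : ∀ v, ∑ i, inner ℝ v (sqrtApply S (ξ i)) ^ 2 ≤ n * (14 * a * s * ‖v‖) ^ 2 := fun v => by
    refine (sum_inner_sqrtApply_sq_le hS (by positivity) hsq v).trans (le_of_eq ?_)
    rw [← ha2]; ring
  have hR : ‖∑ i, sqrtApply S (ξ i)‖ ≤ n * (3 * a * s * Real.sqrt (q / n)) := by
    have h1 : Real.sqrt (q * τ * n) = n * (a * Real.sqrt (q / n)) := by
      rw [ha, ← Real.sqrt_mul hτ.le, ← Real.sqrt_sq hn'.le, ← Real.sqrt_mul (by positivity),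
        Real.sqrt_sq hn'.le]
      congr 1; field_simp
    calc _ ≤ s * ‖∑ i, ξ i‖ := norm_sum_sqrtApply_le hS
      _ ≤ s * (3 * Real.sqrt (q * τ * n)) := by gcongr
      _ = _ := by rw [h1]; ring
  refine (hm.norm_sub_le hp hn hε0 hD hcard hin (by positivity) hB hR).trans ?_
  rw [div_mul_eq_mul_div]
  refine div_le_div_of_nonneg_right ?_ hD.le
  have h2 : 0 ≤ a * s * Real.sqrt (q / n) := by positivity
  have h3 : 0 ≤ a * s * Real.sqrt ε := by positivity
  linarith

end Deterministic

theorem theorem4 :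
    ∀ τ : ℝ, 0 < τ → ∃ A : ℝ, 0 < A ∧
      ∀ (n p : ℕ), 2 ≤ p → p ≤ n →
      ∀ δ : ℝ, 4 * Real.exp (-(n : ℝ)) < δ → δ < 1 →
      ∀ ε : ℝ, 0 < ε → ε < (5 - Real.sqrt 5) / 10 →
      ∀ S : Matrix (Fin p) (Fin p) ℝ, S.PosSemidef →
      ∀ μ : EuclideanSpace ℝ (Fin p),
      ∀ (Ω : Type*) [MeasurableSpace Ω] (P : Measure Ω) [IsProbabilityMeasure P]
        (X : Fin n → Ω → EuclideanSpace ℝ (Fin p)),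
      IsSGAC P τ μ S ε X →
      ∃ E : Set Ω, MeasurableSet E ∧ 1 - 4 * δ ≤ P.real E ∧
        ∀ ω ∈ E,
          (∃ m, IsIterativelyReweightedMean ε (fun i => X i ω) m) ∧
          ∀ m, IsIterativelyReweightedMean ε (fun i => X i ω) m →
            ‖m - μ‖ ≤
              A * Real.sqrt (opNorm S) / (1 - 2 * ε - Real.sqrt (ε * (1 - ε))) *
                (Real.sqrt ((p + Real.log (4 / δ)) / n) + 3 * Real.sqrt ε) := by
  intro τ hτ
  refine ⟨28 * Real.sqrt τ, by positivity, ?_⟩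
  intro n p hp2 hpn δ hδn hδ1 ε hε0 hε S hS μ Ω _ P _ X hX
  have hp : 0 < p := by omega
  have hn : 0 < n := by omega
  have hδ : 0 < δ := lt_trans (by positivity) hδn
  have hD := one_sub_two_mul_sub_sqrt_pos hε
  obtain ⟨ξ, hξ, hind, hcont⟩ := hX.contaminated
  have hlog0 : 0 < Real.log (4 / δ) := Real.log_pos (by rw [lt_div_iff₀ hδ]; linarith)
  have hlog1 : Real.log (1 / δ) ≤ Real.log (4 / δ) :=
    Real.log_le_log (by positivity) (by gcongr; norm_num)
  have hlogn : Real.log (4 / δ) ≤ n := by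
    rw [Real.log_le_iff_le_exp (by positivity), div_le_iff₀ hδ]
    rw [Real.exp_neg] at hδn
    have := mul_lt_mul_of_pos_left hδn (Real.exp_pos (n : ℝ))
    have h4 : Real.exp (n : ℝ) * (4 * (Real.exp (n : ℝ))⁻¹) = 4 := by
      field_simp
    linarith
  set q := p + Real.log (4 / δ) with hq
  have hq0 : 0 < q := by positivity
  set b₁ := {ω | ¬ (({i : Fin n | X i ω ≠ μ + sqrtApply S (ξ i ω)}.ncard : ℕ) : ℝ) ≤ ε * n} with hb₁
  set b₂ := {ω | ¬ ∀ v, ∑ i, inner ℝ v (ξ i ω) ^ 2 ≤ 196 * τ * n * ‖v‖ ^ 2} with hb₂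
  set b₃ := {ω | ¬ ‖∑ i, ξ i ω‖ ≤ 3 * Real.sqrt (q * τ * n)} with hb₃
  have h1 : P b₁ = 0 := hcont
  have h2 : P b₂ ≤ ENNReal.ofReal δ :=
    measure_sum_inner_sq_gt_le hτ hn hpn hξ hind hδ (hlog1.trans hlogn)
  have h3 : P b₃ ≤ ENNReal.ofReal δ :=
    measure_norm_sum_gt_le hτ hn hξ hind hδ hq0 (by rw [hq]; linarith)
  have hbad : P (b₁ ∪ (b₂ ∪ b₃)) ≤ ENNReal.ofReal (2 * δ) := by
    calc P (b₁ ∪ (b₂ ∪ b₃)) ≤ P b₁ + (P b₂ + P b₃) :=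
          (measure_union_le _ _).trans (by gcongr; exact measure_union_le _ _)
      _ ≤ 0 + (ENNReal.ofReal δ + ENNReal.ofReal δ) := by rw [h1]; gcongr
      _ = ENNReal.ofReal (2 * δ) := by
          rw [zero_add, ← ENNReal.ofReal_add hδ.le hδ.le]; congr 1; ring
  -- `b₁ ∪ (b₂ ∪ b₃)` need not be measurable
  refine ⟨(toMeasurable P (b₁ ∪ (b₂ ∪ b₃)))ᶜ, (measurableSet_toMeasurable _ _).compl, ?_, ?_⟩
  · rw [probReal_compl_eq_one_sub (measurableSet_toMeasurable _ _), measureReal_def,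
      measure_toMeasurable]
    have := ENNReal.toReal_le_of_le_ofReal (by positivity) hbad
    linarith
  · intro ω hω
    have hω' : ω ∉ b₁ ∪ (b₂ ∪ b₃) := fun h => hω (subset_toMeasurable P _ h)
    simp only [Set.mem_union, not_or, hb₁, hb₂, hb₃, Set.mem_ofPred_eq, not_not] at hω'
    exact ⟨exists_isIterativelyReweightedMean hp hn hε0 _, fun m hm =>
      norm_sub_le_of_sum_le hp hn hτ hq0 hε0 hD hS hω'.1 hω'.2.1 hω'.2.2 hm⟩
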